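/- Let $(\Theta,\rho)$ be a compact metric space with its Borel $\sigma$-algebra, let $P_0$ be a nonatomic Borel probability measure on $\Theta$, and let $\nu>0$. For $\varepsilon>0$ let $D=D(\varepsilon,\Theta,\rho)$ be the $\varepsilon$-packing number of $\Theta$, that is, the maximal number of points of $\Theta$ with mutual distances at least $\varepsilon$. For $r\ge 1$ let $$W_r(G,G')=\Bigl[\inf_{q}\int \rho(\theta,\theta')^r\,dq(\theta,\theta')\Bigr]^{1/r}$$ be the $L_r$ Wasserstein distance, the infimum being over all couplings $q$ of the Borel probability measures $G,G'$ on $\Theta$. Then there is $\varepsilon_0>0$, depending only on $(\Theta,\rho)$, $P_0$ and $\nu$, such that for all $0<\varepsilon<\varepsilon_0$, all real $r\ge1$ and every Borel probability measure $G_0$ on $\Theta$ (in particular every discrete one, with finitely or countably many atoms), if $\Pi$ denotes the law of the Dirichlet process $G\sim\mathrm{DP}(\nu,P_0)$, then $$\Pi\bigl(G:\ W_r^r(G_0,G)\le(2^r+1)\varepsilon^r\bigr)\ \ge\ \frac{\Gamma(\nu)\,\nu^{D}}{(2D)^{D-1}}\Bigl(\frac{\varepsilon}{\mathrm{Diam}(\Theta)}\Bigr)^{r(D-1)}\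 \sup_{S}\ \prod_{i=1}^{D}P_0(S_i),$$ where the supremum is over all $S=(S_1,\dots,S_D)$ for which $S_1,\dots,S_D$ are the (disjoint) open balls of radius $\varepsilon/2$ around $D$ points of $\Theta$ with mutual distances at least $\varepsilon$, and $\Gamma$ is the gamma function. -/

import Mathlib

open MeasureTheory Set
open scoped ENNReal

noncomputable section

/-- `x` is a family of `n` points of `Θ` that are mutually separated by at least `ε`. -/
def IsPacking {Θ : Type*} [MetricSpace Θ] (ε : ℝ) {n : ℕ} (x : Fin n → Θ) : Prop :=
  ∀ i j, i ≠ j → ε ≤ dist (x i) (x j)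

/-- The packing number `D(ε, Θ, ρ)`: the maximal number of points of `Θ` that are mutually
separated by at least `ε` (a genuine maximum if `Θ` is compact and `0 < ε`). -/
def packNum (Θ : Type*) [MetricSpace Θ] (ε : ℝ) : ℕ :=
  sSup {n : ℕ | ∃ x : Fin n → Θ, IsPacking ε x}

/-- The couplings of two probability measures. -/
def Couplings {Θ : Type*} [MeasurableSpace Θ] (G G' : ProbabilityMeasure Θ) :
    Set (Measure (Θ × Θ)) :=
  {γ | γ.map Prod.fst = (G : Measure Θ) ∧ γ.map Prod.snd = (G' : Measure Θ)}

/-- The transportation distance `d_{ρ ^ r}(G, G')`: the infimum of the mean of `ρ ^ r` over all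
couplings of `G` and `G'`. For discrete `G = ∑ pᵢ δ_{θᵢ}` and `G' = ∑ p'ⱼ δ_{θ'ⱼ}` every coupling
has the form `∑ qᵢⱼ δ_{(θᵢ, θ'ⱼ)}`, and the integral is `∑ qᵢⱼ ρ(θᵢ, θ'ⱼ) ^ r`. -/
def transportCost {Θ : Type*} [MetricSpace Θ] [MeasurableSpace Θ] (r : ℝ)
    (G G' : ProbabilityMeasure Θ) : ℝ≥0∞ :=
  ⨅ γ ∈ Couplings G G', ∫⁻ z, edist z.1 z.2 ^ r ∂γ

/-- The Wasserstein distance `W_r`, with `W_r ^ r = d_{ρ ^ r}`. -/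
def wasserstein {Θ : Type*} [MetricSpace Θ] [MeasurableSpace Θ] (r : ℝ)
    (G G' : ProbabilityMeasure Θ) : ℝ≥0∞ :=
  transportCost r G G' ^ (1 / r)

/-- The density of the first `n` coordinates of a Dirichlet vector with the `n + 1` positive
parameters `α 0, …, α n`, with respect to Lebesgue measure on `ℝⁿ`. -/
def dirichletDensity {n : ℕ} (α : Fin (n + 1) → ℝ) (x : Fin n → ℝ) : ℝ :=
  open Classical in
  if (∀ i, 0 < x i) ∧ ∑ i, x i < 1 then
    Real.Gamma (∑ i, α i) / (∏ i, Real.Gamma (α i)) *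
      ((∏ i : Fin n, x i ^ (α i.castSucc - 1)) * (1 - ∑ i, x i) ^ (α (Fin.last n) - 1))
  else 0

/-- The Dirichlet distribution `Dir(α 0, …, α n)` with positive parameters: the law of
`(x 0, …, x (n - 1), 1 - ∑ x i)` where `x` has the density `dirichletDensity α`. -/
def dirichletLaw {n : ℕ} (α : Fin (n + 1) → ℝ) : Measure (Fin (n + 1) → ℝ) :=
  ((volume : Measure (Fin n → ℝ)).withDensity
      fun x => ENNReal.ofReal (dirichletDensity α x)).map
    fun x => Fin.snoc (α := fun _ => ℝ) x (1 - ∑ i, x i)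

/-- `Q` is the law on probability measures of the Dirichlet process `DP(ν, P₀)`: for each finite
measurable partition `A 0, …, A n` of `Θ`, the vector `(G (A 0), …, G (A n))` has the law
`Dir(ν P₀(A 0), …, ν P₀(A n))`. As usual, a zero parameter of a Dirichlet vector means that the
coordinate vanishes almost surely; this is the first clause, and after it only partitions into
sets of positive `P₀`-measure remain, which is the second clause. -/
structure IsDirichletProcess {Θ : Type*} [MeasurableSpace Θ] (ν : ℝ) (P₀ : Measure Θ)
    (Q : Measure (ProbabilityMeasure Θ)) : Prop where
  null : ∀ A : Set Θ, MeasurableSet A → P₀ A = 0 →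
    ∀ᵐ (G : ProbabilityMeasure Θ) ∂Q, (G : Measure Θ) A = 0
  partition : ∀ (n : ℕ) (A : Fin (n + 1) → Set Θ), (∀ i, MeasurableSet (A i)) →
    Pairwise (fun i j => Disjoint (A i) (A j)) → (⋃ i, A i) = univ → (∀ i, 0 < P₀ (A i)) →
    Q.map (fun (G : ProbabilityMeasure Θ) i => (G : Measure Θ).real (A i)) = dirichletLaw fun i => ν * P₀.real (A i)

end

/-! Around a maximal `ε`-packing, partition `Θ` into cells `A i`, each between the balls of radii `ε
/ 2` and `ε`. Put `η = (ε / diam) ^ r`. If `G (A i) ≥ (1 - η) G₀ (A i)` for all `i`, then mass `1 -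
η` moves inside cells at cost at most `(2ε) ^ r`, and mass `η` moves anywhere at total cost at most
`η diam ^ r = ε ^ r` (`transportCost_le_of_partition`). The cell masses of `G` form a Dirichlet
vector. Nonatomicity makes its parameters at most `1` for small `ε`, so its density is at least
`Γ(ν) ∏ ν P₀(A i)`, and integrating this over a cube of side `η / (2D)` gives the bound
(`le_dirichletLaw`). -/

/-! ### Small balls, packings and partitions. -/

theorem exists_forall_measure_ball_le {Θ : Type*} [MetricSpace Θ] [CompactSpace Θ]
    [MeasurableSpace Θ] [BorelSpace Θ] (P₀ : Measure Θ) [IsFiniteMeasure P₀]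
    [NullSingletonClass P₀] {c : ℝ≥0∞} (hc : 0 < c) :
    ∃ δ : ℝ, 0 < δ ∧ ∀ x, P₀ (Metric.ball x δ) ≤ c := by
  have h : ∀ x : Θ, ∃ U : Set Θ, {x} ⊆ U ∧ IsOpen U ∧ P₀ U < c := fun x =>
    Set.exists_isOpen_lt_of_lt {x} c (by simpa using hc)
  choose U hxU hU hUc using h
  obtain ⟨δ, hδ, hb⟩ := lebesgue_number_lemma_of_metric (isCompact_univ (X := Θ)) hU
    (fun x _ => mem_iUnion.2 ⟨x, hxU x rfl⟩)
  refine ⟨δ, hδ, fun x => ?_⟩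
  obtain ⟨i, hi⟩ := hb x (mem_univ x)
  exact (measure_mono hi).trans (hUc i).le

theorem diam_univ_pos {Θ : Type*} [MetricSpace Θ] [CompactSpace Θ] [Nontrivial Θ] :
    0 < Metric.diam (univ : Set Θ) := by
  obtain ⟨x, y, hxy⟩ := exists_pair_ne Θ
  exact (dist_pos.2 hxy).trans_le
    (Metric.dist_le_diam_of_mem isCompact_univ.isBounded (mem_univ x) (mem_univ y))

/-- Each point of a finite `ε / 2`-net is within `ε / 2` of at most one packing point. Without
boundedness the `sSup` in `packNum` would default to `0`. -/
theorem bddAbove_packing (Θ : Type*) [MetricSpace Θ] [CompactSpace Θ] {ε : ℝ} (hε : 0 < ε) :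
    BddAbove {n : ℕ | ∃ x : Fin n → Θ, IsPacking ε x} := by
  obtain ⟨t, -, ht, hcov⟩ := (isCompact_univ (X := Θ)).finite_cover_balls (half_pos hε)
  have hc : ∀ y : Θ, ∃ z : t, dist y z < ε / 2 := fun y => by
    obtain ⟨z, hz, hyz⟩ := mem_iUnion₂.1 (hcov (mem_univ y))
    exact ⟨⟨z, hz⟩, hyz⟩
  choose c hc using hc
  have := ht.fintype
  refine ⟨Fintype.card t, ?_⟩
  rintro n ⟨x, hx⟩
  simpa using Fintype.card_le_of_injective (fun i => c (x i)) fun i j hij => by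
    by_contra h
    have h1 := hx i j h
    have h2 := dist_triangle_right (x i) (x j) (c (x i))
    have h3 := hc (x j)
    rw [← show c (x i) = c (x j) from hij] at h3
    linarith [hc (x i)]

theorem IsPacking.exists_dist_lt {Θ : Type*} [MetricSpace Θ] [CompactSpace Θ] {ε : ℝ}
    (hε : 0 < ε) {x : Fin (packNum Θ ε) → Θ} (hx : IsPacking ε x) (y : Θ) :
    ∃ i, dist y (x i) < ε := by
  by_contra! h
  refine (Nat.lt_succ_self (packNum Θ ε)).not_ge
    (le_csSup (bddAbove_packing Θ hε) ⟨Fin.cons y x, fun i j => ?_⟩)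
  refine Fin.cases ?_ (fun i => ?_) i <;> refine Fin.cases ?_ (fun j => ?_) j
  · simp
  · intro _; simpa using h j
  · intro _; simpa [dist_comm] using h i
  · intro hij; simpa using hx i j (by simpa using hij)

theorem packNum_pos (Θ : Type*) [MetricSpace Θ] [CompactSpace Θ] [Nonempty Θ] {ε : ℝ}
    (hε : 0 < ε) : 0 < packNum Θ ε :=
  Nat.succ_le_iff.1 (le_csSup (bddAbove_packing Θ hε)
    ⟨fun _ => Classical.arbitrary Θ, fun i j hij => (hij (Subsingleton.elim i j)).elim⟩)

/-- A maximal packing gives a partition into sets lying between the balls of radii `ε / 2`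
and `ε`. -/
theorem IsPacking.exists_partition {Θ : Type*} [MetricSpace Θ] [MeasurableSpace Θ]
    [BorelSpace Θ] {ε : ℝ} {n : ℕ} {x : Fin n → Θ} (hx : IsPacking ε x)
    (hcov : ∀ y, ∃ i, dist y (x i) < ε) :
    ∃ A : Fin n → Set Θ, (∀ i, MeasurableSet (A i)) ∧
      Pairwise (fun i j => Disjoint (A i) (A j)) ∧ (⋃ i, A i) = univ ∧
      ∀ i, Metric.ball (x i) (ε / 2) ⊆ A i ∧ A i ⊆ Metric.ball (x i) ε := by
  have hdisj : ∀ {i j y}, dist y (x i) < ε / 2 → dist y (x j) < ε / 2 → i = j := by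
    intro i j y hi hj
    by_contra hij
    have := hx i j hij
    have := dist_triangle_left (x i) (x j) y
    linarith
  -- Removing the other half-balls in advance ensures that `disjointed`, which favours early
  -- indices, never takes points of the half-ball around `x i` away from cell `i`.
  let C : Fin n → Set Θ := fun i =>
    Metric.ball (x i) ε \ ⋃ j ∈ {j | j ≠ i}, Metric.ball (x j) (ε / 2)
  have hC : ∀ i, MeasurableSet (C i) := fun i =>
    Metric.isOpen_ball.measurableSet.diff
      (MeasurableSet.biUnion (Set.to_countable _) fun j _ => Metric.isOpen_ball.measurableSet)
  have hCcov : (⋃ i, C i) = univ := by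
    refine eq_univ_of_forall fun y => mem_iUnion.2 ?_
    by_cases h : ∃ i, dist y (x i) < ε / 2
    · obtain ⟨i, hi⟩ := h
      refine ⟨i, ?_, ?_⟩
      · have := dist_nonneg (x := y) (y := x i)
        exact Metric.mem_ball.2 (by linarith)
      · simp only [mem_iUnion, Metric.mem_ball, not_exists]
        exact fun j hj hy => hj (hdisj hy hi)
    · obtain ⟨i, hi⟩ := hcov y
      refine ⟨i, hi, ?_⟩
      simp only [mem_iUnion, Metric.mem_ball, not_exists]
      exact fun j _ hy => h ⟨j, hy⟩
  refine ⟨disjointed C, fun i => disjointedRec (fun _ j ht => ht.diff (hC j)) (hC i), disjoint_disjointed C,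
    (iUnion_disjointed).trans hCcov, fun i => ⟨fun y hy => ?_, ?_⟩⟩
  · have hy' := Metric.mem_ball.1 hy
    obtain ⟨j, hj⟩ := mem_iUnion.1
      (((iUnion_disjointed (f := C)).trans hCcov).symm ▸ mem_univ y :)
    by_cases hji : j = i
    · exact hji ▸ hj
    · exact ((disjointed_subset C j hj).2 (mem_biUnion (Ne.symm hji) hy)).elim
  · exact (disjointed_subset C i).trans sdiff_subset

/-! ### Transport through a partition. -/

theorem transportCost_le_of_partition {Θ : Type*} [MetricSpace Θ] [MeasurableSpace Θ] {r : ℝ}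
    (hr : 0 ≤ r) (G₀ G : ProbabilityMeasure Θ) {ι : Type*} [Fintype ι] {A : ι → Set Θ}
    (hA : ∀ i, MeasurableSet (A i)) (hdisj : Pairwise (fun i j => Disjoint (A i) (A j)))
    (hU : (⋃ i, A i) = univ) {d M s t : ℝ≥0∞} (hst : t + s = 1)
    (hd : ∀ i, ∀ x ∈ A i, ∀ y ∈ A i, edist x y ≤ d) (hM : ∀ x y : Θ, edist x y ≤ M)
    (hpos : ∀ i, (G : Measure Θ) (A i) ≠ 0)
    (hle : ∀ i, t * (G₀ : Measure Θ) (A i) ≤ (G : Measure Θ) (A i)) :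
    transportCost r G₀ G ≤ d ^ r + s * M ^ r := by
  set μ : Measure Θ := (G₀ : Measure Θ)
  set κ : Measure Θ := (G : Measure Θ)
  have hsum : ∀ η : Measure Θ, ∑ i, η.restrict (A i) = η := fun η => by
    rw [← Measure.sum_fintype, ← Measure.restrict_iUnion hdisj hA, hU, Measure.restrict_univ]
  have hsumA : ∀ η : Measure Θ, ∑ i, η (A i) = η univ := fun η => by
    conv_rhs => rw [← hsum η]
    simp
  have htop : ∀ i, κ (A i) ≠ ∞ := fun i => measure_ne_top κ _
  set a : ι → ℝ≥0∞ := fun i => t / κ (A i)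
  have ha : ∀ i, a i * κ (A i) = t := fun i => ENNReal.div_mul_cancel (hpos i) (htop i)
  have ha1 : ∀ i, a i * μ (A i) ≤ 1 := fun i => by
    rw [← ENNReal.mul_div_right_comm]
    exact ENNReal.div_le_of_le_mul (by simpa using hle i)
  set b : ι → ℝ≥0∞ := fun i => 1 - a i * μ (A i)
  have hab : ∀ i, a i * μ (A i) + b i = 1 := fun i => add_tsub_cancel_of_le (ha1 i)
  have ht : t ≠ ∞ := ne_top_of_le_ne_top ENNReal.one_ne_top (hst ▸ le_self_add)
  have hb : ∑ i, b i * κ (A i) = s := by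
    refine (ENNReal.add_right_inj ht).1 ?_
    rw [hst]
    calc t + ∑ i, b i * κ (A i) = t * ∑ i, μ (A i) + ∑ i, b i * κ (A i) := by
          rw [hsumA]; simp [μ]
      _ = ∑ i, (a i * μ (A i) + b i) * κ (A i) := by
          rw [Finset.mul_sum, ← Finset.sum_add_distrib]
          refine Finset.sum_congr rfl fun i _ => ?_
          rw [add_mul, ← ha i]; ring
      _ = 1 := by simp only [hab, one_mul]; rw [hsumA]; simp [κ]
  set κ' : Measure Θ := ∑ i, b i • κ.restrict (A i)
  have hκ' : κ' univ = s := by simpa [κ'] using hb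
  have hs : s ≠ ∞ := ne_top_of_le_ne_top ENNReal.one_ne_top (hst ▸ le_add_self)
  have : IsFiniteMeasure κ' := ⟨by rw [hκ']; exact hs.lt_top⟩
  -- The cell terms have first marginal `t • μ` and use up the share `a i * μ (A i)` of `κ` on `A
  -- i`. The unused part `κ'` of `κ` has mass `s`, so its product with `μ` supplies the missing `s •
  -- μ`.
  set γ : Measure (Θ × Θ) :=
    ∑ i, a i • (μ.restrict (A i)).prod (κ.restrict (A i)) + μ.prod κ'
  have hγ : γ ∈ Couplings G₀ G := by
    constructor
    · rw [Measure.map_add _ _ measurable_fst, Measure.map_finset_sum' (Measurable.aemeasurable (by fun_prop))]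
      simp only [Measure.map_smul, Measure.map_fst_prod, hκ', Measure.restrict_apply_univ,
        smul_smul, ha]
      rw [← Finset.smul_sum, hsum, ← add_smul, hst, one_smul]
    · rw [Measure.map_add _ _ measurable_snd, Measure.map_finset_sum' (Measurable.aemeasurable (by fun_prop))]
      simp only [Measure.map_smul, Measure.map_snd_prod, Measure.restrict_apply_univ,
        smul_smul, κ']
      rw [show μ univ = 1 from measure_univ, one_smul, ← Finset.sum_add_distrib]
      simp only [← add_smul, hab, one_smul, hsum]
      rfl
  refine (iInf₂_le γ hγ).trans ?_
  rw [lintegral_add_measure, lintegral_finsetSum_measure]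
  gcongr
  · calc ∑ i, ∫⁻ z, edist z.1 z.2 ^ r ∂(a i • (μ.restrict (A i)).prod (κ.restrict (A i)))
        ≤ ∑ i, d ^ r * (t * μ (A i)) := by
          refine Finset.sum_le_sum fun i _ => ?_
          rw [lintegral_smul_measure, Measure.prod_restrict, smul_eq_mul]
          calc a i * ∫⁻ z in A i ×ˢ A i, edist z.1 z.2 ^ r ∂μ.prod κ
              ≤ a i * ∫⁻ z in A i ×ˢ A i, d ^ r ∂μ.prod κ := by
                gcongr a i * ?_
                exact setLIntegral_mono' ((hA i).prod (hA i)) fun z hz =>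
                  ENNReal.rpow_le_rpow (hd i _ hz.1 _ hz.2) hr
            _ = d ^ r * (t * μ (A i)) := by
                rw [setLIntegral_const, Measure.prod_prod, ← ha i]; ring
      _ = d ^ r * t := by rw [← Finset.mul_sum, ← Finset.mul_sum, hsumA]; simp [μ]
      _ ≤ d ^ r := mul_le_of_le_one_right' (hst ▸ le_self_add)
  · calc ∫⁻ z, edist z.1 z.2 ^ r ∂μ.prod κ' ≤ ∫⁻ _, M ^ r ∂μ.prod κ' :=
          lintegral_mono fun z => ENNReal.rpow_le_rpow (hM _ _) hr
      _ = s * M ^ r := by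
        rw [lintegral_const, ← univ_prod_univ, Measure.prod_prod, hκ',
          show μ univ = 1 from measure_univ, one_mul, mul_comm]

/-! ### Lower bounds for Dirichlet laws. -/

/-- Convexity and `Γ(1) = Γ(2) = 1` give `a Γ(a) = Γ(a + 1) ≤ 1`. -/
theorem le_inv_Gamma {a : ℝ} (h0 : 0 < a) (h1 : a ≤ 1) : a ≤ (Real.Gamma a)⁻¹ := by
  have h : Real.Gamma (a + 1) ≤ 1 := by
    have := Real.convexOn_Gamma.le_max_of_mem_Icc (x := 1) (y := 2) (z := a + 1)
      (mem_Ioi.2 one_pos) (mem_Ioi.2 two_pos) ⟨by linarith, by linarith⟩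
    simpa [Real.Gamma_one, Real.Gamma_two] using this
  rw [Real.Gamma_add_one h0.ne'] at h
  rwa [le_inv_comm₀ h0 (Real.Gamma_pos_of_pos h0), ← one_div, le_div_iff₀' h0]

/-- Nonpositive exponents on bases in `(0, 1]` make every power at least `1`. -/
theorem le_dirichletDensity {n : ℕ} {α : Fin (n + 1) → ℝ} (h0 : ∀ i, 0 < α i)
    (h1 : ∀ i, α i ≤ 1) {x : Fin n → ℝ} (hx : ∀ i, 0 < x i) (hs : ∑ i, x i < 1) :
    Real.Gamma (∑ i, α i) * ∏ i, α i ≤ dirichletDensity α x := by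
  rw [dirichletDensity, if_pos ⟨hx, hs⟩, div_eq_mul_inv, mul_assoc, ← Finset.prod_inv_distrib]
  have hx1 : ∀ i, x i ≤ 1 := fun i =>
    (Finset.single_le_sum (fun j _ => (hx j).le) (Finset.mem_univ i)).trans hs.le
  have hsx : 0 ≤ ∑ i, x i := Finset.sum_nonneg fun i _ => (hx i).le
  have hΓ : 0 < Real.Gamma (∑ i, α i) :=
    Real.Gamma_pos_of_pos (Finset.sum_pos (fun i _ => h0 i) Finset.univ_nonempty)
  have hprod : ∏ i, α i ≤ ∏ i, (Real.Gamma (α i))⁻¹ :=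
    Finset.prod_le_prod (fun i _ => (h0 i).le) fun i _ => le_inv_Gamma (h0 i) (h1 i)
  gcongr
  refine hprod.trans (le_mul_of_one_le_right
    (Finset.prod_nonneg fun i _ => inv_nonneg.2 (Real.Gamma_pos_of_pos (h0 i)).le) ?_)
  refine one_le_mul_of_one_le_of_one_le (Finset.prod_induction _ (1 ≤ ·)
    (fun _ _ => one_le_mul_of_one_le_of_one_le) le_rfl fun i _ => ?_) ?_
  · exact Real.one_le_rpow_of_pos_of_le_one_of_nonpos (hx i) (hx1 i) (by linarith [h1 i.castSucc])
  · exact Real.one_le_rpow_of_pos_of_le_one_of_nonpos (by linarith) (by linarith)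
      (by linarith [h1 (Fin.last n)])

/-- Mass that a Dirichlet law with parameters at most `1` gives to the vectors dominating `t • p`,
for a probability vector `p`. -/
theorem le_dirichletLaw {n : ℕ} {α : Fin (n + 1) → ℝ} (h0 : ∀ i, 0 < α i) (h1 : ∀ i, α i ≤ 1)
    {p : Fin (n + 1) → ℝ} (hp : ∀ i, 0 ≤ p i) (hp1 : ∑ i, p i = 1) {t c : ℝ} (ht : 0 ≤ t)
    (htc : t + n * c < 1) :
    ENNReal.ofReal (Real.Gamma (∑ i, α i) * ∏ i, α i) * ENNReal.ofReal c ^ n ≤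
      dirichletLaw α {y | ∀ i, 0 < y i ∧ t * p i ≤ y i} := by
  have hB : MeasurableSet {y : Fin (n + 1) → ℝ | ∀ i, 0 < y i ∧ t * p i ≤ y i} := by
    simp only [ofPred_forall, ofPred_and]
    exact MeasurableSet.iInter fun i => (measurableSet_lt measurable_const
      (measurable_pi_apply i)).inter (measurableSet_le measurable_const (measurable_pi_apply i))
  have hf : Measurable fun x : Fin n → ℝ =>
      (Fin.snoc (α := fun _ => ℝ) x (1 - ∑ i, x i) : Fin (n + 1) → ℝ) := by
    refine measurable_pi_lambda _ fun i => ?_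
    refine Fin.lastCases ?_ (fun i => ?_) i
    · simp only [Fin.snoc_last]; fun_prop
    · simp only [Fin.snoc_castSucc]; fun_prop
  -- By `htc` the cube is small enough that the last coordinate `1 - ∑ x i` exceeds `t * p (Fin.last
  -- n)` automatically.
  set I : Set (Fin n → ℝ) :=
    univ.pi fun i => Ioo (t * p i.castSucc) (t * p i.castSucc + c)
  have hI : ∀ x ∈ I, (∀ i, 0 < x i) ∧ ∑ i, x i + t * p (Fin.last n) < 1 := fun x hx => by
    have hx' : ∀ i, x i ∈ Ioo (t * p i.castSucc) (t * p i.castSucc + c) :=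
      fun i => hx i (mem_univ i)
    refine ⟨fun i => (mul_nonneg ht (hp _)).trans_lt (hx' i).1, ?_⟩
    have h2 : ∑ i, x i ≤ ∑ i : Fin n, (t * p i.castSucc + c) :=
      Finset.sum_le_sum fun i _ => (hx' i).2.le
    rw [Finset.sum_add_distrib, ← Finset.mul_sum] at h2
    rw [Fin.sum_univ_castSucc] at hp1
    simp only [Finset.sum_const, Finset.card_univ, Fintype.card_fin, nsmul_eq_mul] at h2
    rw [← eq_sub_iff_add_eq] at hp1
    rw [hp1] at h2
    linarith
  have hlast : 0 ≤ t * p (Fin.last n) := mul_nonneg ht (hp _)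
  calc ENNReal.ofReal (Real.Gamma (∑ i, α i) * ∏ i, α i) * ENNReal.ofReal c ^ n
      = ∫⁻ _ in I, ENNReal.ofReal (Real.Gamma (∑ i, α i) * ∏ i, α i) := by
        rw [setLIntegral_const, Real.volume_pi_Ioo]; simp
    _ ≤ ∫⁻ x in I, ENNReal.ofReal (dirichletDensity α x) :=
        setLIntegral_mono' (MeasurableSet.univ_pi fun _ => measurableSet_Ioo) fun x hx =>
          ENNReal.ofReal_le_ofReal
            (le_dirichletDensity h0 h1 (hI x hx).1 (by linarith [(hI x hx).2]))
    _ = (volume.withDensity fun x => ENNReal.ofReal (dirichletDensity α x)) I :=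
        (withDensity_apply _ (MeasurableSet.univ_pi fun _ => measurableSet_Ioo)).symm
    _ ≤ _ := by
        rw [dirichletLaw, Measure.map_apply hf hB]
        refine measure_mono fun x hx i => ?_
        refine Fin.lastCases ?_ (fun i => ?_) i
        · simp only [Fin.snoc_last]
          constructor <;> linarith [(hI x hx).2]
        · simp only [Fin.snoc_castSucc]
          exact ⟨(hI x hx).1 i, (hx i (mem_univ i)).1.le⟩

/-! ### Wasserstein balls under the Dirichlet process. -/

theorem wasserstein_rpow {Θ : Type*} [MetricSpace Θ] [MeasurableSpace Θ] {r : ℝ} (hr : r ≠ 0)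
    (G G' : ProbabilityMeasure Θ) : wasserstein r G G' ^ r = transportCost r G G' := by
  rw [wasserstein, ← ENNReal.rpow_mul, one_div_mul_cancel hr, ENNReal.rpow_one]

theorem wasserstein_rpow_le_of_partition {Θ : Type*} [MetricSpace Θ] [CompactSpace Θ]
    [MeasurableSpace Θ] {r ε η : ℝ} (hr : 0 < r) (hε : 0 < ε) (hη0 : 0 ≤ η) (hη1 : η ≤ 1)
    (hη : η * Metric.diam (univ : Set Θ) ^ r ≤ ε ^ r)
    (G₀ G : ProbabilityMeasure Θ) {ι : Type*} [Fintype ι] {A : ι → Set Θ}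
    (hA : ∀ i, MeasurableSet (A i)) (hdisj : Pairwise (fun i j => Disjoint (A i) (A j)))
    (hU : (⋃ i, A i) = univ) {x : ι → Θ} (hball : ∀ i, A i ⊆ Metric.ball (x i) ε)
    (h : ∀ i, 0 < (G : Measure Θ).real (A i) ∧
      (1 - η) * (G₀ : Measure Θ).real (A i) ≤ (G : Measure Θ).real (A i)) :
    wasserstein r G₀ G ^ r ≤ ENNReal.ofReal ((2 ^ r + 1) * ε ^ r) := by
  rw [wasserstein_rpow hr.ne']
  have hη1' : 0 ≤ 1 - η := sub_nonneg.2 hη1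
  have hdiam : 0 ≤ Metric.diam (univ : Set Θ) := Metric.diam_nonneg
  refine (transportCost_le_of_partition hr.le G₀ G hA hdisj hU
    (t := ENNReal.ofReal (1 - η)) (s := ENNReal.ofReal η) (d := ENNReal.ofReal (2 * ε))
    (M := ENNReal.ofReal (Metric.diam (univ : Set Θ))) ?_ ?_ ?_ ?_ ?_).trans ?_
  · rw [← ENNReal.ofReal_add hη1' hη0]; simp
  · intro i y hy z hz
    rw [edist_dist]
    refine ENNReal.ofReal_le_ofReal ?_
    have hy' := Metric.mem_ball.1 (hball i hy)
    have hz' := Metric.mem_ball.1 (hball i hz)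
    linarith [dist_triangle_right y z (x i)]
  · intro y z
    rw [edist_dist]
    exact ENNReal.ofReal_le_ofReal
      (Metric.dist_le_diam_of_mem isCompact_univ.isBounded (mem_univ y) (mem_univ z))
  · intro i hi
    exact (h i).1.ne' (by simp [Measure.real, hi])
  · intro i
    rw [← ofReal_measureReal (μ := (G : Measure Θ)), ← ofReal_measureReal (μ := (G₀ : Measure Θ)),
      ← ENNReal.ofReal_mul hη1']
    exact ENNReal.ofReal_le_ofReal (h i).2
  · rw [ENNReal.ofReal_rpow_of_nonneg (by positivity) hr.le,
      ENNReal.ofReal_rpow_of_nonneg hdiam hr.le, ← ENNReal.ofReal_mul hη0,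
      ← ENNReal.ofReal_add (by positivity) (by positivity), Real.mul_rpow two_pos.le hε.le]
    exact ENNReal.ofReal_le_ofReal (by linarith)

theorem IsDirichletProcess.le_measure_wasserstein {Θ : Type*} [MetricSpace Θ] [CompactSpace Θ]
    [MeasurableSpace Θ] [BorelSpace Θ] {P₀ : Measure Θ} [IsProbabilityMeasure P₀] {ν : ℝ}
    (hν : 0 < ν) {ε r η : ℝ} (hε : 0 < ε) (hr : 0 < r) (hη0 : 0 < η) (hη1 : η ≤ 1)
    (hη : η * Metric.diam (univ : Set Θ) ^ r ≤ ε ^ r) (G₀ : ProbabilityMeasure Θ)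
    {Q : Measure (ProbabilityMeasure Θ)} (hQ : IsDirichletProcess ν P₀ Q) {n : ℕ}
    {x : Fin (n + 1) → Θ} (hx : IsPacking ε x) (hcov : ∀ y, ∃ i, dist y (x i) < ε)
    (hP : ∀ y, P₀ (Metric.ball y ε) ≤ ENNReal.ofReal (1 / ν)) :
    ENNReal.ofReal (Real.Gamma ν * ν ^ (n + 1) * (η / (2 * (n + 1))) ^ n) *
        ∏ i, P₀ (Metric.ball (x i) (ε / 2)) ≤
      Q {G | wasserstein r G₀ G ^ r ≤ ENNReal.ofReal ((2 ^ r + 1) * ε ^ r)} := by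
  obtain ⟨A, hA, hdisj, hU, hball⟩ := hx.exists_partition hcov
  -- A null cell contains a null half-ball, so the left side vanishes.
  by_cases hpos : ∀ i, 0 < P₀ (A i)
  swap
  · push Not at hpos
    obtain ⟨i, hi⟩ := hpos
    rw [Finset.prod_eq_zero (Finset.mem_univ i)
      (le_zero_iff.1 ((measure_mono (hball i).1).trans hi))]
    simp
  have hsum : ∀ (μ : Measure Θ) [IsProbabilityMeasure μ], ∑ i, μ.real (A i) = 1 := by
    intro μ _
    rw [← measureReal_iUnion_fintype hdisj hA, hU]
    simp
  have hpos' : ∀ i, 0 < P₀.real (A i) := fun i =>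
    ENNReal.toReal_pos (hpos i).ne' (measure_ne_top _ _)
  have hα1 : ∀ i, ν * P₀.real (A i) ≤ 1 := fun i => by
    have := ENNReal.toReal_le_of_le_ofReal (by positivity)
      ((measure_mono (hball i).2).trans (hP (x i)))
    rwa [le_div_iff₀' hν] at this
  have hF : Measurable fun (G : ProbabilityMeasure Θ) i => (G : Measure Θ).real (A i) :=
    measurable_pi_lambda _ fun i =>
      ((Measure.measurable_coe (hA i)).comp measurable_subtype_coe).ennreal_toReal
  have hn : (0 : ℝ) < 2 * (n + 1) := by positivity
  -- Side `η / (n + 1)` would already do; the factor `2` is slack present in the stated constant.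
  have hc : 1 - η + n * (η / (2 * (n + 1))) < 1 := by
    have : n * (η / (2 * (n + 1))) < η := by
      rw [mul_div_assoc', div_lt_iff₀ hn]
      nlinarith
    linarith
  have hD := le_dirichletLaw (fun i => mul_pos hν (hpos' i)) hα1
    (p := fun i => (G₀ : Measure Θ).real (A i)) (fun _ => measureReal_nonneg) (hsum _)
    (sub_nonneg.2 hη1) hc
  rw [← hQ.partition n A hA hdisj hU hpos] at hD
  have hK : ENNReal.ofReal (Real.Gamma ν * ν ^ (n + 1) * (η / (2 * (n + 1))) ^ n) *
        ∏ i, P₀ (Metric.ball (x i) (ε / 2)) ≤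
      ENNReal.ofReal (Real.Gamma (∑ i, ν * P₀.real (A i)) * ∏ i, ν * P₀.real (A i)) *
        ENNReal.ofReal (η / (2 * (n + 1))) ^ n := by
    have hΓ := Real.Gamma_pos_of_pos hν
    calc _ ≤ ENNReal.ofReal (Real.Gamma ν * ν ^ (n + 1) * (η / (2 * (n + 1))) ^ n) *
          ∏ i, P₀ (A i) := by
          gcongr with i
          exact (hball i).1
      _ = _ := by
          have hreal : ∏ i, P₀ (A i) = ∏ i, ENNReal.ofReal (P₀.real (A i)) :=
            Finset.prod_congr rfl fun i _ => (ofReal_measureReal (μ := P₀)).symm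
          rw [hreal, ← ENNReal.ofReal_prod_of_nonneg fun _ _ => measureReal_nonneg,
            ← ENNReal.ofReal_pow (by positivity), ← ENNReal.ofReal_mul (by positivity),
            ← ENNReal.ofReal_mul (mul_nonneg (by rw [← Finset.mul_sum, hsum, mul_one]; exact hΓ.le)
              (Finset.prod_nonneg fun i _ => (mul_pos hν (hpos' i)).le)),
            ← Finset.mul_sum, hsum, mul_one, Finset.prod_mul_distrib]
          congr 1
          simp
          ring
  refine hK.trans (hD.trans ?_)
  rw [Measure.map_apply hF]
  · exact measure_mono fun G hG => wasserstein_rpow_le_of_partition hr hε hη0.le hη1 hη G₀ G hA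
      hdisj hU (fun i => (hball i).2) hG
  · simp only [ofPred_forall, ofPred_and]
    exact MeasurableSet.iInter fun i => (measurableSet_lt measurable_const
      (measurable_pi_apply i)).inter (measurableSet_le measurable_const (measurable_pi_apply i))

theorem mainTheorem10 {Θ : Type*} [MetricSpace Θ] [CompactSpace Θ] [MeasurableSpace Θ]
    [BorelSpace Θ] (P₀ : Measure Θ) [IsProbabilityMeasure P₀] [NullSingletonClass P₀]
    (ν : ℝ) (hν : 0 < ν) :
    ∃ ε₀ : ℝ, 0 < ε₀ ∧ ∀ ε : ℝ, 0 < ε → ε < ε₀ →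
      ∀ (r : ℝ), 1 ≤ r → ∀ (G₀ : ProbabilityMeasure Θ)
        (Q : Measure (ProbabilityMeasure Θ)), IsProbabilityMeasure Q →
        IsDirichletProcess ν P₀ Q →
        ENNReal.ofReal
            (Real.Gamma ν * ν ^ packNum Θ ε / (2 * (packNum Θ ε : ℝ)) ^ (packNum Θ ε - 1) *
              (ε / Metric.diam (univ : Set Θ)) ^ (r * ((packNum Θ ε : ℝ) - 1))) *
          (⨆ x ∈ {x : Fin (packNum Θ ε) → Θ | IsPacking ε x},
            ∏ i, P₀ (Metric.ball (x i) (ε / 2)))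
        ≤ Q {G | wasserstein r G₀ G ^ r ≤ ENNReal.ofReal ((2 ^ r + 1) * ε ^ r)} := by
  have hne : Nonempty Θ := P₀.nonempty_of_neZero
  -- A one-point space carries only an atom; nontriviality makes the diameter positive.
  have hnt : Nontrivial Θ := by
    by_contra h
    rw [not_nontrivial_iff_subsingleton] at h
    obtain ⟨x⟩ := hne
    have h0 := measure_singleton (μ := P₀) x
    rw [Subsingleton.eq_univ_of_nonempty (singleton_nonempty x), measure_univ] at h0
    exact one_ne_zero h0
  have hdiam := diam_univ_pos (Θ := Θ)
  obtain ⟨δ, hδ, hP⟩ := exists_forall_measure_ball_le P₀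
    (ENNReal.ofReal_pos.2 (one_div_pos.2 hν))
  -- `ε < δ` keeps the Dirichlet parameters at most `1`; `ε < diam` gives `η ≤ 1`.
  refine ⟨min δ (Metric.diam (univ : Set Θ)), lt_min hδ hdiam, ?_⟩
  intro ε hε hεlt r hr G₀ Q _ hQ
  obtain ⟨hεδ, hεd⟩ := lt_min_iff.1 hεlt
  simp only [ENNReal.mul_iSup]
  refine iSup₂_le fun x hx => ?_
  have hcov := IsPacking.exists_dist_lt hε hx
  have hDpos := packNum_pos Θ hε
  generalize packNum Θ ε = D at x hx hcov hDpos ⊢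
  obtain ⟨n, rfl⟩ := Nat.exists_eq_add_one.2 hDpos
  have hq : 0 < ε / Metric.diam (univ : Set Θ) := div_pos hε hdiam
  have hr0 : 0 < r := one_pos.trans_le hr
  have key := hQ.le_measure_wasserstein hν hε hr0 (Real.rpow_pos_of_pos hq r)
    (Real.rpow_le_one hq.le ((div_le_one hdiam).2 hεd.le) hr0.le)
    (by rw [Real.div_rpow hε.le hdiam.le, div_mul_cancel₀ _ (Real.rpow_pos_of_pos hdiam r).ne'])
    G₀ hx hcov fun y => (measure_mono (Metric.ball_subset_ball hεδ.le)).trans (hP y)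
  refine (le_of_eq ?_).trans key
  congr 2
  rw [div_pow, ← Real.rpow_mul_natCast hq.le]
  push_cast
  rw [add_sub_cancel_right]
  ring
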